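/- For a finite set $F\subseteq\mathbb{Z}$ let $\ell^2(\mathbb{N})^{\otimes F}$ denote the Hilbert space tensor product of copies of $\ell^2(\mathbb{N})$ indexed by the sites of $F$ (so $\ell^2(\mathbb{N})^{\otimes\varnothing}=\mathbb{C}$), and let $\mathcal{B}(\ell^2(\mathbb{N})^{\otimes F})$ be the algebra of all bounded operators on it. For finite sets $F\subseteq F'$, the unital injective $*$-homomorphism $a\mapsto a\otimes 1_{F'\setminus F}$ embeds $\mathcal{B}(\ell^2(\mathbb{N})^{\otimes F})$ into $\mathcal{B}(\ell^2(\mathbb{N})^{\otimes F'})$. Let $$\mathcal{L}^{\infty}:=\operatorname{colim}_{I}\,\mathcal{B}(\ell^2(\mathbb{N})^{\otimes I})$$ be the C*-algebraic colimit (the norm completion of the algebraic direct limit) over the bounded, possibly empty intervals $I\subseteq\mathbb{Z}$, ordered by inclusion. For a finite set $F\subseteq\mathbb{Z}$ let $\mathcal{L}^{\infty}_F\subseteq\mathcal{L}^{\infty}$ be the image of $\mathcal{B}(\ell^2(\mathbb{N})^{\otimes F})$ under $a\mapsto a\otimes 1_{I\setminus F}\in\mathcal{B}(\ell^2(\mathbb{N})^{\otimes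 I})\to\mathcal{L}^{\infty}$, where $I$ is any bounded interval containing $F$ (the image does not depend on $I$). For the complement $F^c=\mathbb{Z}\setminus F$ of a finite set $F$ let $\mathcal{L}^{\infty}_{F^c}$ be the C*-subalgebra of $\mathcal{L}^{\infty}$ generated by all $\mathcal{L}^{\infty}_I$ with $I\subseteq F^c$ a bounded interval. Theorem (strong algebraic Haag duality). For every finite subset $F\subseteq\mathbb{Z}$, $$\{x\in\mathcal{L}^{\infty} : xy-yx=0\ \text{ for all } y\in\mathcal{L}^{\infty}_{F^c}\}=\mathcal{L}^{\infty}_F .$$ -/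

import Mathlib

noncomputable section

/-! ### Amplification `a ↦ a ⊗ 1` on `ℓ²`

For a splitting `e : Y ≃ X × Z` of an index set, `ℓ²(Y) ≅ ℓ²(X) ⊗ ℓ²(Z)`, and
`amplify e a` is the operator `a ⊗ 1` on `ℓ²(Y)`. -/

namespace Amplification

/-- The Hilbert space `ℓ²(X)` with complex coefficients. -/
abbrev L2 (X : Type) : Type := lp (fun _ : X => ℂ) 2

variable {X Y Z : Type}

lemma memlp_two_iff {f : X → ℂ} : Memℓp f 2 ↔ Summable fun x => ‖f x‖ ^ 2 := by
  rw [memℓp_gen_iff (by norm_num)]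
  simp

lemma summable_sq (ξ : L2 X) : Summable fun x => ‖ξ x‖ ^ 2 :=
  memlp_two_iff.1 (lp.memℓp ξ)

lemma norm_sq_eq (ξ : L2 X) : ‖ξ‖ ^ 2 = ∑' x, ‖ξ x‖ ^ 2 := by
  have := lp.norm_rpow_eq_tsum (p := 2) (by norm_num) ξ
  simpa using this

/-- The slice `x ↦ ξ (x, z)` of a vector `ξ ∈ ℓ²(X × Z)`. -/
def slice (e : Y ≃ X × Z) (ξ : L2 Y) (z : Z) : L2 X :=
  ⟨fun x => ξ (e.symm (x, z)), memlp_two_iff.2 <|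
    (summable_sq ξ).comp_injective (i := fun x => e.symm (x, z)) fun x x' h => by
      simpa using h⟩

@[simp] lemma slice_apply (e : Y ≃ X × Z) (ξ : L2 Y) (z : Z) (x : X) :
    slice e ξ z x = ξ (e.symm (x, z)) := rfl

lemma summable_prod (e : Y ≃ X × Z) (ξ : L2 Y) :
    Summable fun p : Z × X => ‖ξ (e.symm (p.2, p.1))‖ ^ 2 :=
  (summable_sq ξ).comp_injective (i := fun p : Z × X => e.symm (p.2, p.1)) fun p p' h => by
    have := e.symm.injective h
    ext <;> simp_all

lemma summable_slice (e : Y ≃ X × Z) (ξ : L2 Y) : Summable fun z => ‖slice e ξ z‖ ^ 2 := by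
  simpa [norm_sq_eq] using (summable_prod e ξ).prod

lemma norm_sq_slice (e : Y ≃ X × Z) (ξ : L2 Y) : ‖ξ‖ ^ 2 = ∑' z, ‖slice e ξ z‖ ^ 2 := by
  simp only [norm_sq_eq, slice_apply]
  rw [← (summable_prod e ξ).tsum_prod]
  exact (((Equiv.prodComm Z X).trans e.symm).tsum_eq (fun y => ‖ξ y‖ ^ 2)).symm

lemma summable_family (g : Z → L2 X) (hg : Summable fun z => ‖g z‖ ^ 2) :
    Summable fun p : Z × X => ‖g p.1 p.2‖ ^ 2 := by
  have h0 : 0 ≤ fun p : Z × X => ‖g p.1 p.2‖ ^ 2 := fun p => pow_nonneg (norm_nonneg _) 2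
  refine (summable_prod_of_nonneg h0).2 ⟨fun z => summable_sq (g z), ?_⟩
  simpa only [← norm_sq_eq] using hg

/-- The vector of `ℓ²(X × Z)` with prescribed slices. -/
def ofSlices (e : Y ≃ X × Z) (g : Z → L2 X) (hg : Summable fun z => ‖g z‖ ^ 2) : L2 Y :=
  ⟨fun y => g (e y).2 (e y).1, memlp_two_iff.2 <|
    (e.trans (Equiv.prodComm X Z)).summable_iff.2 (summable_family g hg)⟩

lemma slice_ofSlices (e : Y ≃ X × Z) (g : Z → L2 X) (hg : Summable fun z => ‖g z‖ ^ 2) (z : Z) :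
    slice e (ofSlices e g hg) z = g z := by
  ext x; simp [ofSlices]

lemma summable_amplify (e : Y ≃ X × Z) (a : L2 X →L[ℂ] L2 X) (ξ : L2 Y) :
    Summable fun z => ‖a (slice e ξ z)‖ ^ 2 := by
  refine Summable.of_nonneg_of_le (fun _ => pow_nonneg (norm_nonneg _) 2) (fun z => ?_)
    ((summable_slice e ξ).mul_left (‖a‖ ^ 2))
  rw [← mul_pow]
  exact pow_le_pow_left₀ (norm_nonneg _) (a.le_opNorm _) 2

/-- The vector `(a ⊗ 1) ξ`, i.e. `a` applied to every slice of `ξ`. -/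
def amplifyVec (e : Y ≃ X × Z) (a : L2 X →L[ℂ] L2 X) (ξ : L2 Y) : L2 Y :=
  ofSlices e (fun z => a (slice e ξ z)) (summable_amplify e a ξ)

@[simp] lemma amplifyVec_apply (e : Y ≃ X × Z) (a : L2 X →L[ℂ] L2 X) (ξ : L2 Y) (y : Y) :
    amplifyVec e a ξ y = a (slice e ξ (e y).2) (e y).1 := rfl

@[simp] lemma slice_amplifyVec (e : Y ≃ X × Z) (a : L2 X →L[ℂ] L2 X) (ξ : L2 Y) (z : Z) :
    slice e (amplifyVec e a ξ) z = a (slice e ξ z) := by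
  ext x; simp

lemma norm_amplifyVec_le (e : Y ≃ X × Z) (a : L2 X →L[ℂ] L2 X) (ξ : L2 Y) :
    ‖amplifyVec e a ξ‖ ≤ ‖a‖ * ‖ξ‖ := by
  refine le_of_sq_le_sq ?_ (by positivity)
  rw [mul_pow, norm_sq_slice e, norm_sq_slice e ξ, ← tsum_mul_left]
  refine (summable_slice e _).tsum_le_tsum (fun z => ?_) ((summable_slice e ξ).mul_left _)
  rw [slice_amplifyVec, ← mul_pow]
  exact pow_le_pow_left₀ (norm_nonneg _) (a.le_opNorm _) 2

lemma slice_add (e : Y ≃ X × Z) (ξ η : L2 Y) (z : Z) :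
    slice e (ξ + η) z = slice e ξ z + slice e η z := by ext; simp

lemma slice_smul (e : Y ≃ X × Z) (c : ℂ) (ξ : L2 Y) (z : Z) :
    slice e (c • ξ) z = c • slice e ξ z := by ext; simp

/-- The bounded operator `a ⊗ 1` on `ℓ²(Y) ≅ ℓ²(X) ⊗ ℓ²(Z)`. -/
def amplifyCLM (e : Y ≃ X × Z) (a : L2 X →L[ℂ] L2 X) : L2 Y →L[ℂ] L2 Y :=
  LinearMap.mkContinuous
    { toFun := amplifyVec e a
      map_add' := fun ξ η => by ext; simp [slice_add]
      map_smul' := fun c ξ => by ext; simp [slice_smul] }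
    ‖a‖ (norm_amplifyVec_le e a)

@[simp] lemma amplifyCLM_apply (e : Y ≃ X × Z) (a : L2 X →L[ℂ] L2 X) (ξ : L2 Y) (y : Y) :
    amplifyCLM e a ξ y = a (slice e ξ (e y).2) (e y).1 := rfl

@[simp] lemma slice_amplifyCLM (e : Y ≃ X × Z) (a : L2 X →L[ℂ] L2 X) (ξ : L2 Y) (z : Z) :
    slice e (amplifyCLM e a ξ) z = a (slice e ξ z) :=
  slice_amplifyVec e a ξ z

lemma inner_slice (e : Y ≃ X × Z) (ξ η : L2 Y) :
    inner ℂ ξ η = ∑' z, inner ℂ (slice e ξ z) (slice e η z) := by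
  simp only [lp.inner_eq_tsum, slice_apply]
  have hs : Summable fun p : Z × X =>
      inner ℂ (ξ (e.symm (p.2, p.1))) (η (e.symm (p.2, p.1))) :=
    ((Equiv.prodComm Z X).trans e.symm).summable_iff.2 (lp.summable_inner (𝕜 := ℂ) ξ η)
  rw [← hs.tsum_prod]
  exact (((Equiv.prodComm Z X).trans e.symm).tsum_eq (fun y => inner ℂ (ξ y) (η y))).symm

/-- The unital `*`-homomorphism `a ↦ a ⊗ 1` from `B(ℓ²(X))` to
`B(ℓ²(Y)) ≅ B(ℓ²(X) ⊗ ℓ²(Z))`. -/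
def amplify (e : Y ≃ X × Z) : (L2 X →L[ℂ] L2 X) →⋆ₐ[ℂ] (L2 Y →L[ℂ] L2 Y) where
  toFun := amplifyCLM e
  map_one' := by ext; simp
  map_mul' a b := by ext; simp
  map_zero' := by ext; simp
  map_add' a b := by ext; simp
  commutes' c := by ext; simp [Algebra.algebraMap_eq_smul_one]
  map_star' a := by
    rw [ContinuousLinearMap.star_eq_adjoint (amplifyCLM e a), ContinuousLinearMap.eq_adjoint_iff]
    intro ξ η
    rw [inner_slice e, inner_slice e]
    simp [ContinuousLinearMap.star_eq_adjoint, ContinuousLinearMap.adjoint_inner_left]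

@[simp] lemma amplify_apply (e : Y ≃ X × Z) (a : L2 X →L[ℂ] L2 X) (ξ : L2 Y) (y : Y) :
    amplify e a ξ y = a (slice e ξ (e y).2) (e y).1 := rfl

/-- `(a ⊗ 1)(u ⊗ v) = (a u) ⊗ v`, written out in coordinates. -/
lemma amplify_tensor (e : Y ≃ X × Z) (a : L2 X →L[ℂ] L2 X) (u : L2 X) (v : L2 Z) (ξ : L2 Y)
    (hξ : ∀ y, ξ y = u (e y).1 * v (e y).2) (y : Y) :
    amplify e a ξ y = (a u) (e y).1 * v (e y).2 := by
  have : slice e ξ (e y).2 = v (e y).2 • u := by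
    ext x; simp [hξ, mul_comm]
  simp [this, mul_comm]

lemma amplify_injective (e : Y ≃ X × Z) [Nonempty Z] : Function.Injective (amplify e) := by
  classical
  intro a b hab
  obtain ⟨z⟩ := ‹Nonempty Z›
  ext u x
  have hg : Summable fun z' => ‖(if z' = z then u else 0 : L2 X)‖ ^ 2 :=
    summable_of_ne_finset_zero (s := {z}) fun z' hz' => by simp_all
  let ξ : L2 Y := ofSlices e (fun z' => if z' = z then u else 0) hg
  have hs : slice e ξ z = u := by simp [ξ, slice_ofSlices]
  have := congrArg (fun T => slice e (T ξ) z) hab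
  have h2 : ∀ c, slice e (amplify e c ξ) z = c u := fun c => by
    rw [← hs]; exact slice_amplifyCLM e c ξ z
  simp only [h2] at this
  rw [this]

end Amplification

/-! ### The C*-algebraic colimit of a directed system

For a directed system of unital C*-algebras with isometric (equivalently, injective) unital
connecting `*`-homomorphisms, the algebraic direct limit carries a canonical C*-norm, and the
colimit in the category of C*-algebras is its completion. -/

namespace CStarColimit

open UniformSpace


variable {ι : Type} [Preorder ι] [IsDirectedOrder ι] [Nonempty ι]
variable (G : ι → Type) [∀ i, CStarAlgebra (G i)]
variable (f : ∀ i j, i ≤ j → G i →⋆ₐ[ℂ] G j) [DirectedSystem G (f · · ·)]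

/-- All connecting maps of the system are isometric. -/
class IsometricSystem : Prop where
  norm_map : ∀ i j (h : i ≤ j) (x : G i), ‖f i j h x‖ = ‖x‖

variable [IsometricSystem G f]

/-- The algebraic direct limit of the system. -/
abbrev Alg : Type := DirectLimit G f

instance instNorm : Norm (Alg G f) where
  norm := DirectLimit.lift f (fun _ x => ‖x‖)
    fun i j h x => (IsometricSystem.norm_map (f := f) i j h x).symm

lemma norm_mk (i : ι) (x : G i) : ‖(⟦⟨i, x⟩⟧ : Alg G f)‖ = ‖x‖ := rfl

instance instNormedAddCommGroup : NormedAddCommGroup (Alg G f) :=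
  AddGroupNorm.toNormedAddCommGroup
    { toFun := fun x => ‖x‖
      map_zero' := by
        obtain ⟨i⟩ := ‹Nonempty ι›
        rw [DirectLimit.zero_def i, norm_mk, norm_zero]
      add_le' := DirectLimit.induction₂ _ fun i x y => by
        rw [DirectLimit.add_def, norm_mk, norm_mk, norm_mk]
        exact norm_add_le x y
      neg' := DirectLimit.induction _ fun i x => by
        rw [DirectLimit.neg_def, norm_mk, norm_mk, norm_neg]
      eq_zero_of_map_eq_zero' := DirectLimit.induction _ fun i x hx => by
        rw [norm_mk, norm_eq_zero] at hx
        rw [hx, ← DirectLimit.zero_def i] }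

instance instNormedRing : NormedRing (Alg G f) where
  __ := instNormedAddCommGroup G f
  __ := (inferInstance : Ring (Alg G f))
  norm_mul_le := DirectLimit.induction₂ _ fun i x y => by
    rw [DirectLimit.mul_def, norm_mk, norm_mk, norm_mk]
    exact norm_mul_le x y

instance instNormedAlgebra : NormedAlgebra ℂ (Alg G f) where
  norm_smul_le c := DirectLimit.induction _ fun i x => by
    rw [DirectLimit.smul_def, norm_mk, norm_mk]
    exact norm_smul_le c x

instance instStarRing : StarRing (Alg G f) where
  star_add := star_add

instance instCStarRing : CStarRing (Alg G f) where
  norm_mul_self_le := DirectLimit.induction _ fun i x => by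
    rw [DirectLimit.star_def, DirectLimit.mul_def, norm_mk, norm_mk]
    exact CStarRing.norm_mul_self_le x

/-- The C*-algebraic colimit: the completion of the algebraic direct limit. -/
def Colim : Type := Completion (Alg G f)

instance : NormedRing (Colim G f) := inferInstanceAs (NormedRing (Completion (Alg G f)))
instance : CompleteSpace (Colim G f) := inferInstanceAs (CompleteSpace (Completion (Alg G f)))
instance : Algebra ℂ (Colim G f) := inferInstanceAs (Algebra ℂ (Completion (Alg G f)))

instance : NormedAlgebra ℂ (Colim G f) where
  norm_smul_le := norm_smul_le (β := Completion (Alg G f))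

/-- The canonical map from the algebraic direct limit to its completion. -/
def coe (x : Alg G f) : Colim G f := (x : Completion (Alg G f))

/-- The star operation is the continuous extension of the one on the direct limit. -/
instance : Star (Colim G f) where
  star := Completion.map (star : Alg G f → Alg G f)

lemma uniformContinuous_star' : UniformContinuous (star : Alg G f → Alg G f) :=
  (starNormedAddGroupHom : NormedAddGroupHom (Alg G f) (Alg G f)).uniformContinuous

lemma coe_star (x : Alg G f) : coe G f (star x) = star (coe G f x) :=
  (Completion.map_coe (uniformContinuous_star' G f) x).symm

lemma continuous_star' : Continuous (star : Colim G f → Colim G f) :=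
  Completion.continuous_map

lemma colim_induction {p : Colim G f → Prop} (x : Colim G f) (hp : IsClosed {x | p x})
    (ih : ∀ x, p (coe G f x)) : p x :=
  Completion.induction_on x hp ih

lemma colim_induction₂ {p : Colim G f → Colim G f → Prop} (x y : Colim G f)
    (hp : IsClosed {x : Colim G f × Colim G f | p x.1 x.2})
    (ih : ∀ x y, p (coe G f x) (coe G f y)) : p x y :=
  Completion.induction_on₂ x y hp ih

lemma coe_add (x y : Alg G f) : coe G f (x + y) = coe G f x + coe G f y :=
  Completion.coe_add x y

lemma coe_mul (x y : Alg G f) : coe G f (x * y) = coe G f x * coe G f y :=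
  Completion.coe_mul x y

lemma coe_smul (c : ℂ) (x : Alg G f) : coe G f (c • x) = c • coe G f x :=
  Completion.coe_smul c x

lemma norm_coe (x : Alg G f) : ‖coe G f x‖ = ‖x‖ :=
  Completion.norm_coe x

instance : StarRing (Colim G f) where
  star_involutive x := by
    have hc := continuous_star' G f
    refine colim_induction G f (p := fun x => star (star x) = x) x
      (isClosed_eq (hc.comp hc) continuous_id) fun x => ?_
    rw [← coe_star, ← coe_star, star_star]
  star_mul x y := by
    have hc := continuous_star' G f
    refine colim_induction₂ G f (p := fun x y => star (x * y) = star y * star x) x y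
      (isClosed_eq (hc.comp continuous_mul)
        ((hc.comp continuous_snd).mul (hc.comp continuous_fst))) fun x y => ?_
    rw [← coe_mul, ← coe_star, ← coe_star, ← coe_star, ← coe_mul, star_mul]
  star_add x y := by
    have hc := continuous_star' G f
    refine colim_induction₂ G f (p := fun x y => star (x + y) = star x + star y) x y
      (isClosed_eq (hc.comp continuous_add)
        ((hc.comp continuous_fst).add (hc.comp continuous_snd))) fun x y => ?_
    rw [← coe_add, ← coe_star, ← coe_star, ← coe_star, ← coe_add, star_add]

instance : CStarRing (Colim G f) where
  norm_mul_self_le x := by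
    have hc := continuous_star' G f
    refine colim_induction G f (p := fun x => ‖x‖ * ‖x‖ ≤ ‖star x * x‖) x
      (isClosed_le (continuous_norm.mul continuous_norm)
        ((hc.mul continuous_id).norm)) fun x => ?_
    rw [← coe_star, ← coe_mul, norm_coe, norm_coe]
    exact CStarRing.norm_mul_self_le x

instance : StarModule ℂ (Colim G f) where
  star_smul c x := by
    have hc := continuous_star' G f
    refine colim_induction G f (p := fun x => star (c • x) = star c • star x) x
      (isClosed_eq (hc.comp (continuous_const_smul c)) (hc.const_smul (star c))) fun x => ?_
    rw [← coe_smul, ← coe_star, ← coe_star, ← coe_smul, star_smul]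

instance : CStarAlgebra (Colim G f) where

/-- The canonical `*`-homomorphism from a member of the system to the colimit. -/
def of (i : ι) : G i →⋆ₐ[ℂ] Colim G f where
  toFun x := coe G f ⟦⟨i, x⟩⟧
  map_one' := by rw [← DirectLimit.one_def i]; rfl
  map_zero' := by rw [← DirectLimit.zero_def i]; rfl
  map_mul' x y := by rw [← DirectLimit.mul_def, coe_mul]
  map_add' x y := by rw [← DirectLimit.add_def, coe_add]
  commutes' c := by rw [← DirectLimit.algebraMap_def i]; rfl
  map_star' x := by rw [← DirectLimit.star_def, coe_star]

lemma of_map (i j : ι) (h : i ≤ j) (x : G i) : of G f j (f i j h x) = of G f i x :=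
  congrArg (coe G f) (DirectLimit.mk_apply i j x h)

lemma norm_of (i : ι) (x : G i) : ‖of G f i x‖ = ‖x‖ :=
  (norm_coe G f _).trans (norm_mk G f i x)

lemma dense_iUnion_range_of : Dense (⋃ i, Set.range (of G f i)) := by
  have h : DenseRange (coe G f) := Completion.denseRange_coe
  refine Dense.mono ?_ h
  rintro _ ⟨x, rfl⟩
  induction x using DirectLimit.induction with
  | _ i x => exact Set.mem_iUnion.2 ⟨i, x, rfl⟩

end CStarColimit

/-! ### The quasi-local algebra `𝓛^∞` over `ℤ` -/

namespace QuasiLocal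

open Amplification

/-- The Hilbert space tensor power `ℓ²(ℕ)^{⊗ F} = ℓ²(ℕ^F)`; the elementary tensor
`⊗_{k ∈ F} e_{n k}` of standard basis vectors is the basis vector of `ℓ²(ℕ^F)` at `n`. -/
abbrev Hilb (F : Finset ℤ) : Type := L2 (F → ℕ)

/-- `B(ℓ²(ℕ)^{⊗ F})`. -/
abbrev Op (F : Finset ℤ) : Type := Hilb F →L[ℂ] Hilb F

/-- For `F ⊆ F'`, the splitting `ℕ^{F'} ≃ ℕ^F × ℕ^{F' \ F}`. -/
def split {F F' : Finset ℤ} (h : F ⊆ F') : (F' → ℕ) ≃ (F → ℕ) × (↥(F' \ F) → ℕ) where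
  toFun n := (fun k => n ⟨k, h k.2⟩, fun k => n ⟨k, (Finset.mem_sdiff.1 k.2).1⟩)
  invFun p k := if hk : (k : ℤ) ∈ F then p.1 ⟨k, hk⟩
    else p.2 ⟨k, Finset.mem_sdiff.2 ⟨k.2, hk⟩⟩
  left_inv n := by
    funext k
    by_cases hk : (k : ℤ) ∈ F <;> simp [hk]
  right_inv p := by
    ext k
    · simp
    · have hk := (Finset.mem_sdiff.1 k.2).2
      simp [hk]

/-- For `F ⊆ F'`, the inclusion `a ↦ a ⊗ 1` of `B(ℓ²(ℕ)^{⊗ F})` into `B(ℓ²(ℕ)^{⊗ F'})`. -/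
def incl {F F' : Finset ℤ} (h : F ⊆ F') : Op F →⋆ₐ[ℂ] Op F' := amplify (split h)

lemma incl_self {F : Finset ℤ} (h : F ⊆ F) (a : Op F) : incl h a = a := by
  ext ξ n
  have h1 : slice (split h) ξ (split h n).2 = ξ := by
    ext m
    simp [split]
  simp only [incl, amplify_apply, h1]
  rfl

lemma incl_incl {F F' F'' : Finset ℤ} (h : F ⊆ F') (h' : F' ⊆ F'') (a : Op F) :
    incl h' (incl h a) = incl (h.trans h') a := by
  ext ξ n
  have h1 : slice (split h) (slice (split h') ξ (split h' n).2) (split h (split h' n).1).2 =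
      slice (split (h.trans h')) ξ (split (h.trans h') n).2 := by
    ext m
    simp only [slice_apply]
    refine congrArg (ξ : (F'' → ℕ) → ℂ) (funext fun k => ?_)
    by_cases hk : (k : ℤ) ∈ F
    · simp [split, hk, h hk]
    · by_cases hk' : (k : ℤ) ∈ F' <;> simp [split, hk, hk']
  simp only [incl, amplify_apply, h1]
  rfl

lemma incl_injective {F F' : Finset ℤ} (h : F ⊆ F') : Function.Injective (incl h) :=
  amplify_injective _

/-- Bounded (possibly empty) intervals of `ℤ`, ordered by inclusion. -/
abbrev Intvl : Type := {I : Finset ℤ // (I : Set ℤ).OrdConnected}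

/-- The smallest interval containing a finite set. -/
def hull (F : Finset ℤ) : Intvl :=
  if h : F.Nonempty then ⟨Finset.Icc (F.min' h) (F.max' h), by
    rw [Finset.coe_Icc]; exact Set.ordConnected_Icc⟩
  else ⟨∅, by rw [Finset.coe_empty]; exact Set.ordConnected_empty⟩

lemma subset_hull (F : Finset ℤ) : F ⊆ (hull F).1 := by
  intro k hk
  have h : F.Nonempty := ⟨k, hk⟩
  simp only [hull, h, dif_pos, Finset.mem_Icc]
  exact ⟨F.min'_le k hk, F.le_max' k hk⟩

lemma hull_eq_self (I : Intvl) : hull I.1 = I := by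
  refine Subtype.ext (Finset.Subset.antisymm ?_ (subset_hull _))
  by_cases h : I.1.Nonempty
  · simp only [hull, h, dif_pos]
    intro k hk
    exact I.2.out (I.1.min'_mem h) (I.1.max'_mem h) (Finset.mem_Icc.1 hk)
  · simp [hull, h]

instance : Nonempty Intvl := ⟨hull ∅⟩

instance : IsDirectedOrder Intvl where
  directed I J := ⟨hull (I.1 ∪ J.1),
    Finset.subset_union_left.trans (subset_hull _),
    Finset.subset_union_right.trans (subset_hull _)⟩

/-- The local algebra `𝓛^∞_I = B(ℓ²(ℕ)^{⊗ I})` of an interval. -/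
abbrev net (I : Intvl) : Type := Op I.1

/-- The connecting maps `a ↦ a ⊗ 1` of the net of local algebras. -/
abbrev netMap (I J : Intvl) (h : I ≤ J) : net I →⋆ₐ[ℂ] net J := incl h

instance : DirectedSystem net (netMap · · ·) where
  map_self _ a := incl_self _ a
  map_map _ _ _ h h' a := incl_incl h h' a

instance : CStarColimit.IsometricSystem net netMap where
  norm_map _ _ h a := NonUnitalStarAlgHom.norm_map (netMap _ _ h) (incl_injective h) a

/-- The quasi-local C*-algebra `𝓛^∞ = colim_I B(ℓ²(ℕ)^{⊗ I})`, the C*-algebraic colimit over the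
bounded intervals of `ℤ`. -/
abbrev LInf : Type := CStarColimit.Colim net netMap

/-- The local subalgebra `𝓛^∞_F ⊆ 𝓛^∞` of an arbitrary finite set `F ⊆ ℤ`: the image of
`B(ℓ²(ℕ)^{⊗ F})` under `a ↦ a ⊗ 1 ∈ B(ℓ²(ℕ)^{⊗ I})`, where `I` is the smallest interval
containing `F`. -/
def localAlg (F : Finset ℤ) : StarSubalgebra ℂ LInf :=
  ((CStarColimit.of net netMap (hull F)).comp (incl (subset_hull F))).range

/-- Any interval containing `F` may be used in place of the smallest one. -/
lemma mem_localAlg_iff {F : Finset ℤ} {I : Intvl} (h : F ⊆ I.1) (x : LInf) :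
    x ∈ localAlg F ↔ ∃ a : Op F, CStarColimit.of net netMap I (incl h a) = x := by
  have key : ∀ a : Op F, CStarColimit.of net netMap I (incl h a) =
      CStarColimit.of net netMap (hull F) (incl (subset_hull F) a) := by
    intro a
    obtain ⟨J, hJ, hJ'⟩ := exists_ge_ge I (hull F)
    rw [← CStarColimit.of_map net netMap I J hJ, ← CStarColimit.of_map net netMap (hull F) J hJ',
      netMap, netMap, incl_incl, incl_incl]
  simp only [key]
  rfl

/-- The algebra `𝓛^∞_S` of a (possibly unbounded) region `S ⊆ ℤ`: the C*-subalgebra of `𝓛^∞`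
generated by the local algebras of the bounded intervals contained in `S`. -/
def regionAlg (S : Set ℤ) : StarSubalgebra ℂ LInf :=
  (StarAlgebra.adjoin ℂ
    (⋃ (I : Intvl) (_ : (I.1 : Set ℤ) ⊆ S), (localAlg I.1 : Set LInf))).topologicalClosure

end QuasiLocal

end

noncomputable section

/-!
Operators with disjoint supports commute, and commutants are closed, so `𝓛^∞_F` commutes with
`𝓛^∞_{F^c}`. Conversely, let `x` commute with `𝓛^∞_{F^c}` and let `a` be an approximant of `x`
supported on a finite set `K ⊇ F`. Fix `n` and write `v_m = 1 ⊗ |m⟩⟨n|` for matrix units on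
`K \ F`. They are finite products of one-site matrix units, so `x` commutes with them, even though
the one-site algebras, being infinite-dimensional, do not in general generate
`B(ℓ²(ℕ)^{⊗ (K \ F)})` in norm. Conjugation slices `a`, that is `v_m a v_m* = (a' ⊗ 1) v_m v_m*`
with `a'` supported on `F` and independent of `m`, whereas `v_m x v_m* = x v_m v_m*`. Since the
`v_m` have orthogonal ranges, summing over a finite set `S` of indices gives
`‖(x - a') P_S‖ ≤ ‖x - a‖`, with `P_S = ∑ v_m v_m*`. Hence `‖(a - a' ⊗ 1) P_S‖ ≤ 2 ‖x - a‖` on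
`ℓ²(ℕ)^{⊗ K}`. There the `P_S` converge strongly to `1`, so `‖a - a' ⊗ 1‖ ≤ 2 ‖x - a‖` and
`‖x - a'‖ ≤ 3 ‖x - a‖`. As `𝓛^∞_F` is closed, `x` belongs to it.
-/

lemma norm_sum_mul_star_sq_le {A ι : Type*} [NonUnitalCStarAlgebra A] {s : Finset ι}
    {v w : ι → A} {C : ℝ} (hw : ∀ i ∈ s, ‖w i‖ ≤ C)
    (hw_orth : (s : Set ι).Pairwise fun i j => star (w i) * w j = 0) :
    ‖∑ i ∈ s, w i * star (v i)‖ ^ 2 ≤ C ^ 2 * ‖∑ i ∈ s, v i * star (v i)‖ := by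
  let _ : PartialOrder A := CStarAlgebra.spectralOrder A
  have _ : StarOrderedRing A := CStarAlgebra.spectralOrderedRing A
  set T := ∑ i ∈ s, w i * star (v i) with hT
  have hdiag : star T * T = ∑ i ∈ s, v i * (star (w i) * w i) * star (v i) := by
    rw [hT, star_sum, Finset.sum_mul_sum]
    refine Finset.sum_congr rfl fun i hi => ?_
    rw [Finset.sum_eq_single_of_mem i hi fun j hj hji => ?_]
    · simp only [star_mul, star_star, mul_assoc]
    · rw [star_mul, star_star, mul_assoc, ← mul_assoc (star (w i)), hw_orth hi hj hji.symm,
        zero_mul, mul_zero]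
  have hterm (i) (hi : i ∈ s) :
      v i * (star (w i) * w i) * star (v i) ≤ C ^ 2 • (v i * star (v i)) := by
    refine (CStarAlgebra.star_right_conjugate_le_norm_smul (.star_mul_self _)).trans
      (smul_le_smul_of_nonneg_right ?_ (mul_star_self_nonneg _))
    rw [CStarRing.norm_star_mul_self, ← sq]
    exact pow_le_pow_left₀ (norm_nonneg _) (hw i hi) 2
  calc ‖T‖ ^ 2 = ‖star T * T‖ := by rw [CStarRing.norm_star_mul_self, sq]
    _ ≤ ‖C ^ 2 • ∑ i ∈ s, v i * star (v i)‖ := by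
        refine CStarAlgebra.norm_le_norm_of_nonneg_of_le (star_mul_self_nonneg T) ?_
        rw [hdiag, Finset.smul_sum]
        exact Finset.sum_le_sum hterm
    _ = C ^ 2 * ‖∑ i ∈ s, v i * star (v i)‖ := by
        rw [norm_smul, Real.norm_of_nonneg (sq_nonneg C)]

lemma norm_sum_mul_star_self_le_one {A ι : Type*} [NonUnitalCStarAlgebra A] {s : Finset ι}
    {v : ι → A} (hv : ∀ i ∈ s, ‖v i‖ ≤ 1)
    (hv_orth : (s : Set ι).Pairwise fun i j => star (v i) * v j = 0) :
    ‖∑ i ∈ s, v i * star (v i)‖ ≤ 1 := by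
  have h := norm_sum_mul_star_sq_le (v := v) hv hv_orth
  rw [one_pow, one_mul, sq] at h
  by_contra! hlt
  exact h.not_gt (lt_mul_of_one_lt_left (one_pos.trans hlt) hlt)

lemma norm_sum_mul_mul_star_le {A ι : Type*} [NonUnitalCStarAlgebra A] {s : Finset ι}
    {v : ι → A} (hv : ∀ i ∈ s, ‖v i‖ ≤ 1)
    (hv_orth : (s : Set ι).Pairwise fun i j => star (v i) * v j = 0) (z : A) :
    ‖∑ i ∈ s, v i * z * star (v i)‖ ≤ ‖z‖ := by
  have hw (i) (hi : i ∈ s) : ‖v i * z‖ ≤ ‖z‖ :=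
    (norm_mul_le _ _).trans (mul_le_of_le_one_left (norm_nonneg z) (hv i hi))
  have hw_orth : (s : Set ι).Pairwise fun i j => star (v i * z) * (v j * z) = 0 := by
    intro i hi j hj hij
    rw [star_mul, mul_assoc, ← mul_assoc (star (v i)), hv_orth hi hj hij, zero_mul, mul_zero]
  refine le_of_sq_le_sq ((norm_sum_mul_star_sq_le hw hw_orth).trans ?_) (norm_nonneg z)
  exact mul_le_of_le_one_right (sq_nonneg _) (norm_sum_mul_star_self_le_one hv hv_orth)

namespace Amplification

open ContinuousLinearMap InnerProductSpace

variable {X Y Z : Type}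

/-- The splitting `e` with its two factors exchanged, so that `amplify (flip e) b` is `1 ⊗ b`. -/
abbrev flip (e : Y ≃ X × Z) : Y ≃ Z × X := e.trans (Equiv.prodComm X Z)

/-- The elementary tensor `u ⊗ v` of `ℓ²(Y) ≅ ℓ²(X) ⊗ ℓ²(Z)`. -/
def tensor (e : Y ≃ X × Z) (u : L2 X) (v : L2 Z) : L2 Y :=
  ofSlices e (fun z => v z • u) <| by
    simpa only [norm_smul, mul_pow] using (summable_sq v).mul_right (‖u‖ ^ 2)

lemma tensor_apply (e : Y ≃ X × Z) (u : L2 X) (v : L2 Z) (y : Y) :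
    tensor e u v y = u (e y).1 * v (e y).2 := mul_comm _ _

lemma slice_tensor (e : Y ≃ X × Z) (u : L2 X) (v : L2 Z) (z : Z) :
    slice e (tensor e u v) z = v z • u := slice_ofSlices _ _ _ _

lemma tensor_flip (e : Y ≃ X × Z) (u : L2 X) (v : L2 Z) : tensor (flip e) v u = tensor e u v := by
  ext y
  simp [tensor_apply, mul_comm]

lemma inner_tensor (e : Y ≃ X × Z) (u u' : L2 X) (v v' : L2 Z) :
    inner ℂ (tensor e u v) (tensor e u' v') = inner ℂ u u' * inner ℂ v v' := by
  simp only [inner_slice e, slice_tensor, inner_smul_left, inner_smul_right, lp.inner_eq_tsum v v',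
    ← tsum_mul_left]
  refine tsum_congr fun z => ?_
  rw [RCLike.inner_apply]
  ring

lemma norm_tensor (e : Y ≃ X × Z) (u : L2 X) (v : L2 Z) : ‖tensor e u v‖ = ‖v‖ * ‖u‖ := by
  rw [← sq_eq_sq₀ (norm_nonneg _) (by positivity), mul_pow, norm_sq_slice e, norm_sq_eq v,
    ← tsum_mul_right]
  simp only [slice_tensor, norm_smul, mul_pow]

lemma amplify_apply_tensor (e : Y ≃ X × Z) (a : L2 X →L[ℂ] L2 X) (u : L2 X) (v : L2 Z) :
    amplify e a (tensor e u v) = tensor e (a u) v := by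
  ext y
  rw [amplify_tensor e a u v _ (tensor_apply e u v), tensor_apply]

lemma amplify_flip_apply_tensor (e : Y ≃ X × Z) (b : L2 Z →L[ℂ] L2 Z) (u : L2 X) (v : L2 Z) :
    amplify (flip e) b (tensor e u v) = tensor e u (b v) := by
  rw [← tensor_flip, amplify_apply_tensor, tensor_flip]

lemma single_eq_tensor [DecidableEq X] [DecidableEq Y] [DecidableEq Z] (e : Y ≃ X × Z) (y : Y)
    (c : ℂ) :
    (lp.single 2 y c : L2 Y) = tensor e (lp.single 2 (e y).1 c) (lp.single 2 (e y).2 1) := by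
  ext y'
  simp only [tensor_apply, lp.single_apply, Pi.single_apply, mul_ite, mul_one, mul_zero,
    ← ite_and, ← e.injective.eq_iff (a := y'), Prod.ext_iff, and_comm]

lemma ext_tensor (e : Y ≃ X × Z) {T T' : L2 Y →L[ℂ] L2 Y}
    (h : ∀ u v, T (tensor e u v) = T' (tensor e u v)) : T = T' := by
  classical
  refine lp.ext_continuousLinearMap (by simp) fun y => ?_
  ext1
  simp only [comp_apply, lp.singleContinuousLinearMap_apply, single_eq_tensor e y, h]

lemma commute_amplify_amplify_flip (e : Y ≃ X × Z) (a : L2 X →L[ℂ] L2 X) (b : L2 Z →L[ℂ] L2 Z) :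
    Commute (amplify e a) (amplify (flip e) b) :=
  ext_tensor e fun u v => by
    simp only [mul_apply_eq_comp, amplify_apply_tensor, amplify_flip_apply_tensor]

lemma amplify_rankOne_mul_amplify_flip_rankOne (e : Y ≃ X × Z) (u u' : L2 X) (v v' : L2 Z) :
    amplify e (rankOne ℂ u u') * amplify (flip e) (rankOne ℂ v v') =
      rankOne ℂ (tensor e u v) (tensor e u' v') :=
  ext_tensor e fun ξ η => by
    rw [mul_apply_eq_comp, amplify_flip_apply_tensor, amplify_apply_tensor, rankOne_apply,
      rankOne_apply, rankOne_apply, inner_tensor]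
    ext y
    simp only [tensor_apply, lp.coeFn_smul, Pi.smul_apply, smul_eq_mul]
    ring

/-- The operator `u ↦ u ⊗ v` from `ℓ²(X)` to `ℓ²(Y)`. Its adjoint contracts the second tensor factor
against `v`. -/
def tensorRight (e : Y ≃ X × Z) (v : L2 Z) : L2 X →L[ℂ] L2 Y :=
  LinearMap.mkContinuous
    { toFun := fun u => tensor e u v
      map_add' := fun u u' => by ext; simp [tensor_apply, add_mul]
      map_smul' := fun c u => by ext; simp [tensor_apply, mul_assoc] }
    ‖v‖ fun u => (norm_tensor e u v).le

lemma tensorRight_apply (e : Y ≃ X × Z) (v : L2 Z) (u : L2 X) :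
    tensorRight e v u = tensor e u v := rfl

lemma adjoint_tensorRight_tensor (e : Y ≃ X × Z) (w v : L2 Z) (u : L2 X) :
    adjoint (tensorRight e w) (tensor e u v) = inner ℂ w v • u :=
  ext_inner_left ℂ fun u' => by
    rw [adjoint_inner_right, tensorRight_apply, inner_tensor, inner_smul_right, mul_comm]

lemma amplify_comp_tensorRight (e : Y ≃ X × Z) (a : L2 X →L[ℂ] L2 X) (v : L2 Z) :
    amplify e a ∘L tensorRight e v = tensorRight e v ∘L a :=
  ContinuousLinearMap.ext fun u => amplify_apply_tensor e a u v

lemma amplify_flip_rankOne (e : Y ≃ X × Z) (v w : L2 Z) :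
    amplify (flip e) (rankOne ℂ v w) = tensorRight e v ∘L adjoint (tensorRight e w) :=
  ext_tensor e fun ξ η => by
    rw [amplify_flip_apply_tensor, comp_apply, adjoint_tensorRight_tensor, tensorRight_apply,
      rankOne_apply]
    ext y
    simp only [tensor_apply, lp.coeFn_smul, Pi.smul_apply, smul_eq_mul]
    ring

/-- The slice map `id ⊗ ⟨w, · w⟩` from `B(ℓ²(X) ⊗ ℓ²(Z))` to `B(ℓ²(X))`. -/
def sliceMap (e : Y ≃ X × Z) (w : L2 Z) (a : L2 Y →L[ℂ] L2 Y) : L2 X →L[ℂ] L2 X :=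
  adjoint (tensorRight e w) ∘L a ∘L tensorRight e w

lemma rankOne_conj_eq_amplify_sliceMap_mul (e : Y ≃ X × Z) (v w : L2 Z) (a : L2 Y →L[ℂ] L2 Y) :
    amplify (flip e) (rankOne ℂ v w) * a * amplify (flip e) (rankOne ℂ w v) =
      amplify e (sliceMap e w a) * amplify (flip e) (rankOne ℂ v v) := by
  simp only [amplify_flip_rankOne, mul_def, ← comp_assoc, amplify_comp_tensorRight]
  simp only [sliceMap, comp_assoc]

section MatrixUnit

variable [DecidableEq Z]

/-- The matrix unit `|m⟩⟨n|` of `B(ℓ²(Z))`, mapping the basis vector at `n` to the one at `m`. -/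
def matrixUnit (m n : Z) : L2 Z →L[ℂ] L2 Z :=
  rankOne ℂ (lp.single 2 m 1) (lp.single 2 n 1)

lemma norm_matrixUnit (m n : Z) : ‖matrixUnit m n‖ = 1 := by
  rw [matrixUnit, norm_rankOne, lp.norm_single (by simp), lp.norm_single (by simp), norm_one,
    mul_one]

lemma star_matrixUnit (m n : Z) : star (matrixUnit m n) = matrixUnit n m :=
  adjoint_rankOne _ _

lemma matrixUnit_apply_single (m n k : Z) (c : ℂ) :
    matrixUnit m n (lp.single 2 k c) = if n = k then lp.single 2 m c else 0 := by
  rw [matrixUnit, rankOne_apply, lp.inner_single_left]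
  split_ifs with h
  · simp [h, ← lp.single_smul]
  · simp [h]

lemma matrixUnit_mul_matrixUnit_same (m n k : Z) :
    matrixUnit m n * matrixUnit n k = matrixUnit m k := by
  rw [mul_def, matrixUnit, matrixUnit, rankOne_comp_rankOne, inner_self_eq_norm_sq_to_K,
    lp.norm_single (by simp)]
  simp [matrixUnit]

lemma matrixUnit_mul_matrixUnit_of_ne (m l : Z) {n k : Z} (h : n ≠ k) :
    matrixUnit m n * matrixUnit k l = 0 := by
  rw [mul_def, matrixUnit, matrixUnit, rankOne_comp_rankOne, lp.inner_single_left]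
  simp [h]

lemma norm_sum_matrixUnit_le_one (S : Finset Z) : ‖∑ m ∈ S, matrixUnit m m‖ ≤ 1 := by
  have h := norm_sum_mul_star_self_le_one (s := S) (v := fun m => matrixUnit m m)
    (fun m _ => (norm_matrixUnit m m).le)
    (fun m _ k _ hmk => by
      beta_reduce
      rw [star_matrixUnit, matrixUnit_mul_matrixUnit_of_ne _ _ hmk])
  simpa only [star_matrixUnit, matrixUnit_mul_matrixUnit_same] using h

lemma matrixUnit_eq_one [Subsingleton Z] (m n : Z) : matrixUnit m n = 1 := by
  refine lp.ext_continuousLinearMap (by simp) fun k => ?_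
  ext1
  rw [comp_apply, lp.singleContinuousLinearMap_apply, matrixUnit_apply_single,
    if_pos (Subsingleton.elim n k), Subsingleton.elim m k]
  rfl

lemma matrixUnit_eq_amplify_mul_amplify_flip [DecidableEq X] [DecidableEq Y] (e : Y ≃ X × Z)
    (m n : Y) :
    matrixUnit m n = amplify e (matrixUnit (e m).1 (e n).1) *
      amplify (flip e) (matrixUnit (e m).2 (e n).2) := by
  rw [matrixUnit, matrixUnit, matrixUnit, amplify_rankOne_mul_amplify_flip_rankOne,
    ← single_eq_tensor, ← single_eq_tensor]

lemma norm_le_of_forall_norm_mul_amplify_le (e : Y ≃ Z × X) {b : L2 Y →L[ℂ] L2 Y} {C : ℝ}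
    (h : ∀ S : Finset Z, ‖b * amplify e (∑ m ∈ S, matrixUnit m m)‖ ≤ C) : ‖b‖ ≤ C := by
  classical
  refine b.opNorm_le_bound ((norm_nonneg _).trans (h ∅)) fun ξ => ?_
  have hξ := lp.hasSum_single (p := 2) (by simp) ξ
  refine le_of_tendsto_of_tendsto ((b.continuous.tendsto ξ).comp hξ).norm
    (hξ.norm.const_mul C) (.of_forall fun W => ?_)
  let S := W.image fun y => (e y).1
  have hfix : amplify e (∑ m ∈ S, matrixUnit m m) (∑ y ∈ W, lp.single 2 y (ξ y)) =
      ∑ y ∈ W, lp.single 2 y (ξ y) := by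
    rw [map_sum]
    refine Finset.sum_congr rfl fun y hy => ?_
    have hyS : (e y).1 ∈ S := Finset.mem_image_of_mem _ hy
    simp only [single_eq_tensor e y, amplify_apply_tensor, sum_apply, matrixUnit_apply_single,
      Finset.sum_ite_eq', hyS, if_true]
  simpa only [Function.comp_apply, mul_apply_eq_comp, hfix] using
    (b * amplify e (∑ m ∈ S, matrixUnit m m)).le_of_opNorm_le (h S) (∑ y ∈ W, lp.single 2 y (ξ y))

variable {A : Type*} [CStarAlgebra A] (π : (L2 Y →L[ℂ] L2 Y) →⋆ₐ[ℂ] A) (e : Y ≃ X × Z) (n : Z)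
  {x : A}

lemma norm_sub_amplify_sliceMap_mul_le
    (hx : ∀ m, Commute x (π (amplify (flip e) (matrixUnit m n)))) (a : L2 Y →L[ℂ] L2 Y)
    (S : Finset Z) :
    ‖(x - π (amplify e (sliceMap e (lp.single 2 n 1) a))) *
        π (amplify (flip e) (∑ m ∈ S, matrixUnit m m))‖ ≤ ‖x - π a‖ := by
  let ρ := π.comp (amplify (flip e))
  let v : Z → A := fun m => ρ (matrixUnit m n)
  have hv_star (m) : star (v m) = ρ (matrixUnit n m) := by rw [← map_star, star_matrixUnit]
  have hv_proj (m) : v m * star (v m) = ρ (matrixUnit m m) := by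
    rw [hv_star, ← map_mul, matrixUnit_mul_matrixUnit_same]
  have hv_norm (m) : ‖v m‖ ≤ 1 :=
    (NonUnitalStarAlgHom.norm_apply_le ρ _).trans_eq (norm_matrixUnit m n)
  have hv_orth (m k) (hmk : m ≠ k) : star (v m) * v k = 0 := by
    rw [hv_star, ← map_mul, matrixUnit_mul_matrixUnit_of_ne _ _ hmk, map_zero]
  have hv_conj (m) : v m * π a * star (v m) =
      π (amplify e (sliceMap e (lp.single 2 n 1) a)) * (v m * star (v m)) := by
    rw [hv_proj, hv_star]
    have h := congrArg π
      (rankOne_conj_eq_amplify_sliceMap_mul e (lp.single 2 m 1) (lp.single 2 n 1) a)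
    rw [map_mul, map_mul, map_mul] at h
    exact h
  have hx_conj (m) : v m * x * star (v m) = x * (v m * star (v m)) := by
    have hcomm : x * v m = v m * x := (hx m).eq
    rw [← mul_assoc, hcomm]
  calc _ = ‖∑ m ∈ S, v m * (x - π a) * star (v m)‖ := by
        simp only [mul_sub, sub_mul, hv_conj, hx_conj, hv_proj, map_sum, Finset.mul_sum,
          Finset.sum_sub_distrib]
        rfl
    _ ≤ ‖x - π a‖ :=
        norm_sum_mul_mul_star_le (fun m _ => hv_norm m) (fun m _ k _ => hv_orth m k) _

lemma norm_sub_amplify_sliceMap_le (hπ : Isometry π)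
    (hx : ∀ m, Commute x (π (amplify (flip e) (matrixUnit m n)))) (a : L2 Y →L[ℂ] L2 Y) :
    ‖x - π (amplify e (sliceMap e (lp.single 2 n 1) a))‖ ≤ 3 * ‖x - π a‖ := by
  set c := amplify e (sliceMap e (lp.single 2 n 1) a)
  have hπ_norm (b) : ‖π b‖ = ‖b‖ := hπ.norm_map_of_map_zero (map_zero π) b
  have hP (S : Finset Z) : ‖π (amplify (flip e) (∑ m ∈ S, matrixUnit m m))‖ ≤ 1 :=
    (NonUnitalStarAlgHom.norm_apply_le (π.comp (amplify (flip e))) _).trans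
      (norm_sum_matrixUnit_le_one S)
  have hac : ‖π a - π c‖ ≤ 2 * ‖x - π a‖ := by
    rw [← map_sub, hπ_norm]
    refine norm_le_of_forall_norm_mul_amplify_le (flip e) fun S => ?_
    set P := amplify (flip e) (∑ m ∈ S, matrixUnit m m)
    calc ‖(a - c) * P‖ = ‖(x - π c) * π P - (x - π a) * π P‖ := by
          rw [← hπ_norm, map_mul, map_sub, ← sub_mul, sub_sub_sub_cancel_left]
      _ ≤ ‖x - π a‖ + ‖x - π a‖ :=
          norm_sub_le_of_le (norm_sub_amplify_sliceMap_mul_le π e n hx a S)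
            ((norm_mul_le _ _).trans (mul_le_of_le_one_right (norm_nonneg _) (hP S)))
      _ = 2 * ‖x - π a‖ := (two_mul _).symm
  calc ‖x - π c‖ = ‖(x - π a) + (π a - π c)‖ := by rw [sub_add_sub_cancel]
    _ ≤ ‖x - π a‖ + 2 * ‖x - π a‖ := norm_add_le_of_le le_rfl hac
    _ = 3 * ‖x - π a‖ := by ring

end MatrixUnit

end Amplification

namespace QuasiLocal

open Amplification CStarColimit

/-- The embedding of `B(ℓ²(ℕ)^{⊗ F})` into the quasi-local algebra, with range `𝓛^∞_F`. -/
def toLInf (F : Finset ℤ) : Op F →⋆ₐ[ℂ] LInf :=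
  (of net netMap (hull F)).comp (incl (subset_hull F))

lemma toLInf_mem_localAlg {F : Finset ℤ} (a : Op F) : toLInf F a ∈ localAlg F := ⟨a, rfl⟩

lemma of_incl {F : Finset ℤ} {I : Intvl} (h : F ⊆ I.1) (a : Op F) :
    of net netMap I (incl h a) = toLInf F a := by
  obtain ⟨J, hIJ, hFJ⟩ := exists_ge_ge I (hull F)
  rw [toLInf, StarAlgHom.comp_apply, ← of_map net netMap I J hIJ,
    ← of_map net netMap (hull F) J hFJ, netMap, netMap, incl_incl, incl_incl]

lemma toLInf_incl {F K : Finset ℤ} (h : F ⊆ K) (a : Op F) : toLInf K (incl h a) = toLInf F a := by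
  rw [← of_incl (subset_hull K), incl_incl, of_incl]

lemma isometry_toLInf (F : Finset ℤ) : Isometry (toLInf F) :=
  AddMonoidHomClass.isometry_of_norm _ fun a =>
    (norm_of net netMap _ _).trans
      (NonUnitalStarAlgHom.norm_map (incl (subset_hull F)) (incl_injective _) a)

lemma isClosed_localAlg (F : Finset ℤ) : IsClosed (localAlg F : Set LInf) :=
  (isometry_toLInf F).isClosedEmbedding.isClosed_range

lemma exists_norm_sub_toLInf_lt (x : LInf) (F : Finset ℤ) {ε : ℝ} (hε : 0 < ε) :
    ∃ K, F ⊆ K ∧ ∃ a : Op K, ‖x - toLInf K a‖ < ε := by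
  obtain ⟨_, hy, hxy⟩ := (dense_iUnion_range_of net netMap).exists_dist_lt x hε
  obtain ⟨I, a, rfl⟩ := Set.mem_iUnion.1 hy
  refine ⟨F ∪ I.1, Finset.subset_union_left, incl Finset.subset_union_right a, ?_⟩
  rwa [toLInf_incl, ← of_incl subset_rfl, incl_self, ← dist_eq_norm]

lemma incl_sdiff {F K : Finset ℤ} (h : F ⊆ K) (b : Op (K \ F)) :
    incl Finset.sdiff_subset b = amplify (flip (split h)) b := by
  ext ξ n
  have hslice : slice (split Finset.sdiff_subset) ξ (split (F := K \ F) Finset.sdiff_subset n).2 =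
      slice (flip (split h)) ξ (flip (split h) n).2 := by
    ext m
    simp only [slice_apply]
    refine congrArg (ξ : (K → ℕ) → ℂ) (funext fun k => ?_)
    by_cases hk : (k : ℤ) ∈ F <;> simp [split, hk]
  simp only [incl, amplify_apply, hslice]
  rfl

lemma toLInf_amplify_flip {F K : Finset ℤ} (h : F ⊆ K) (b : Op (K \ F)) :
    toLInf K (amplify (flip (split h)) b) = toLInf (K \ F) b := by
  rw [← incl_sdiff, toLInf_incl]

lemma commute_toLInf {F B : Finset ℤ} (h : Disjoint F B) (a : Op F) (b : Op B) :
    Commute (toLInf F a) (toLInf B b) := by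
  have hF : F ⊆ F ∪ B := Finset.subset_union_left
  have hB : B ⊆ (F ∪ B) \ F := (Finset.union_sdiff_cancel_left h).superset
  rw [← toLInf_incl hF, ← toLInf_incl hB, ← toLInf_amplify_flip hF]
  exact (commute_amplify_amplify_flip _ _ _).map (toLInf (F ∪ B))

lemma regionAlg_compl_le_centralizer (F : Finset ℤ) :
    regionAlg ((F : Set ℤ)ᶜ) ≤ StarSubalgebra.centralizer ℂ (localAlg F : Set LInf) := by
  refine StarSubalgebra.topologicalClosure_minimal
    (StarAlgebra.adjoin_le (Set.iUnion₂_subset fun I hI => ?_)) (Set.isClosed_centralizer _)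
  have hdisj : Disjoint F I.1 := Finset.disjoint_right.2 fun k hk => by simpa using hI hk
  rintro _ ⟨b, rfl⟩
  refine (StarSubalgebra.mem_centralizer_iff ℂ).2 ?_
  rintro _ ⟨a, rfl⟩
  exact ⟨commute_toLInf hdisj a b, (map_star (toLInf F) a) ▸ commute_toLInf hdisj (star a) b⟩

lemma localAlg_singleton_le_regionAlg {S : Set ℤ} {k : ℤ} (hk : k ∈ S) :
    localAlg {k} ≤ regionAlg S := fun _ hy =>
  StarSubalgebra.le_topologicalClosure _ <| StarAlgebra.subset_adjoin ℂ _ <|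
    Set.mem_iUnion₂.2 ⟨⟨{k}, by simp [Set.ordConnected_singleton]⟩, by simpa using hk, hy⟩

lemma commute_toLInf_matrixUnit {x : LInf} {B : Finset ℤ}
    (hx : ∀ k ∈ B, ∀ y ∈ localAlg {k}, Commute x y) (m n : B → ℕ) :
    Commute x (toLInf B (matrixUnit m n)) := by
  induction B using Finset.induction_on with
  | empty => simp only [matrixUnit_eq_one, map_one, Commute.one_right]
  | insert k B hk ih =>
    have hB : B ⊆ insert k B := Finset.subset_insert k B
    have hsdiff : insert k B \ B = {k} := by
      rw [Finset.insert_sdiff_of_notMem _ hk, Finset.sdiff_self, insert_empty_eq]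
    rw [matrixUnit_eq_amplify_mul_amplify_flip (split hB), map_mul, toLInf_amplify_flip]
    refine Commute.mul_right ?_ (hx k (Finset.mem_insert_self k B) _ ?_)
    · exact (toLInf_incl hB _).symm ▸ ih (fun j hj => hx j (hB hj)) _ _
    · exact hsdiff ▸ toLInf_mem_localAlg _

lemma mem_localAlg_of_forall_commute_localAlg_singleton {F : Finset ℤ} {x : LInf}
    (hx : ∀ k ∉ F, ∀ y ∈ localAlg {k}, Commute x y) : x ∈ localAlg F := by
  refine (isClosed_localAlg F).closure_subset (Metric.mem_closure_iff.2 fun ε hε => ?_)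
  obtain ⟨K, hF, a, ha⟩ := exists_norm_sub_toLInf_lt x F (div_pos hε three_pos)
  have hx_unit (m) : Commute x (toLInf K (amplify (flip (split hF)) (matrixUnit m 0))) := by
    rw [toLInf_amplify_flip]
    exact commute_toLInf_matrixUnit (fun k hk => hx k (Finset.mem_sdiff.1 hk).2) m 0
  let a' : Op F := sliceMap (split hF) (lp.single 2 0 1) a
  refine ⟨toLInf F a', toLInf_mem_localAlg a', ?_⟩
  calc dist x (toLInf F a') = ‖x - toLInf K (amplify (split hF) a')‖ := by
        rw [dist_eq_norm, ← toLInf_incl hF, incl]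
    _ ≤ 3 * ‖x - toLInf K a‖ :=
        norm_sub_amplify_sliceMap_le _ _ _ (isometry_toLInf K) hx_unit a
    _ < ε := (lt_div_iff₀' three_pos).1 ha

end QuasiLocal

end

theorem mainTheorem7 (F : Finset ℤ) :
    {x : QuasiLocal.LInf | ∀ y ∈ QuasiLocal.regionAlg ((F : Set ℤ)ᶜ), x * y - y * x = 0} =
      (QuasiLocal.localAlg F : Set QuasiLocal.LInf) := by
  ext x
  constructor
  · intro hx
    refine QuasiLocal.mem_localAlg_of_forall_commute_localAlg_singleton fun k hk y hy => ?_
    exact sub_eq_zero.1 (hx y (QuasiLocal.localAlg_singleton_le_regionAlg (by simpa using hk) hy))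
  · intro hx y hy
    have hy := QuasiLocal.regionAlg_compl_le_centralizer F hy
    exact sub_eq_zero.2 ((StarSubalgebra.mem_centralizer_iff ℂ).1 hy x hx).1
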